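/- Let $\Sigma_0$ be a minimal port-Hamiltonian system $\dot x=Ax+Bv$, $z=Cx$ with state in $\mathbb R^n$, $A=(J-R)Q$, $C=B^{\mathsf T}Q$, where $J=-J^{\mathsf T}$, $R=R^{\mathsf T}\succcurlyeq0$ and $Q=Q^{\mathsf T}\succ0$. Consider $\bar n$ copies of $\Sigma_0$ coupled by $$v_i=\sum_{j\neq i}w_{ij}(z_j-z_i)+\sum_{j}g_{ij}u_j,\qquad y_i=\sum_j h_{ij}z_j,$$ with weights $w_{ij}\ge 0$, and let $G=(g_{ij})$, $H=(h_{ij})$. Let $\mathcal G$ be the directed graph on $\{1,\dots,\bar n\}$ with an arc $(i,j)$, $i\ne j$, iff $w_{ji}>0$, and let $\mathcal G_u$ be the undirected graph with an edge $\{i,j\}$, $i\neq j$, iff $w_{ij}+w_{ji}>0$. Assume that $\mathcal G_u$ is a tree and that $\mathcal G$ contains a directed rooted spanning tree as a subgraph (a directed tree on all vertices in which every vertex has exactly one incoming arc, except a single root, which has none). Number and orient the edges of $\mathcal G_u$ arbitrarily. Let $E$ be the oriented incidence matrix, whose column for the edge $(i,j)$ is $e_i-e_j$, let $F$ be the matrix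 whose corresponding column is $w_{ij}e_i-w_{ji}e_j$, and let $L_e=E^{\mathsf T}F$ be the edge Laplacian. The edge system is $$\dot x_e=(I\otimes A-L_e\otimes BC)x_e+(E^{\mathsf T}G\otimes B)u,\qquad y_e=(HFL_e^{-1}\otimes C)x_e,$$ and the dual edge system is $$\dot x_f=(I\otimes A-L_e\otimes BC)x_f+(L_e^{-1}E^{\mathsf T}G\otimes B)u,\qquad y_e=(HF\otimes C)x_f.$$ The edge controllability Gramian $\bar P_e$ is the controllability Gramian $\int_0^\infty e^{\mathcal A t}\mathcal B\mathcal B^{\mathsf T}e^{\mathcal A^{\mathsf T}t}\,dt$ of the edge system, and the edge observability Gramian $\bar Q_f$ is the observability Gramian $\int_0^\infty e^{\mathcal A^{\mathsf T}t}\mathcal C^{\mathsf T}\mathcal C e^{\mathcal A t}\,dt$ of the dual edge system, where $(\mathcal A,\mathcal B,\mathcal C)$ are the matrices of the respective system. Then the following hold. 1. If $\Pi^{c}\succcurlyeq0$ is diagonal and $L_e\Pi^{c}+\Pi^{c}L_e^{\mathsf T}-E^{\mathsf T}GG^{\mathsf T}E\succcurlyeq0$, then the integral defining $\bar P_e$ converges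 and $\bar P_e\preccurlyeq\Pi^{c}\otimes Q^{-1}$. 2. If $\Pi^{o}\succcurlyeq0$ is diagonal and $L_e^{\mathsf T}\Pi^{o}+\Pi^{o}L_e-F^{\mathsf T}H^{\mathsf T}HF\succcurlyeq0$, then the integral defining $\bar Q_f$ converges and $\bar Q_f\preccurlyeq\Pi^{o}\otimes Q$. -/

import Mathlib

open scoped Matrix Kronecker

/-! ### Linear time-invariant systems and their Gramians -/

/-- The system `ẋ = A x + B u`, `y = C x`, with state, input and output spaces `ℝˢ`, `ℝᵐ`, `ℝᵖ`. -/
structure LTISystem (s m p : Type*) where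
  A : Matrix s s ℝ
  B : Matrix s m ℝ
  C : Matrix p s ℝ

namespace LTISystem

variable {s m p : Type*} [Fintype s] [DecidableEq s]

/-- The impulse response `t ↦ C e^{tA} B`. -/
noncomputable def impulseResponse (S : LTISystem s m p) (t : ℝ) : Matrix p m ℝ :=
  S.C * NormedSpace.exp (t • S.A) * S.B

/-- A realization is minimal if no system with the same impulse response (that is, the same
input-output behaviour) has a state space of smaller dimension. -/
def IsMinimal (S : LTISystem s m p) : Prop :=
  ∀ (k : ℕ) (S' : LTISystem (Fin k) m p),
    (∀ t : ℝ, 0 ≤ t → S'.impulseResponse t = S.impulseResponse t) → Fintype.card s ≤ k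

/-- The integrand `e^{tA} B Bᵀ e^{tAᵀ}` of the controllability Gramian. -/
noncomputable def ctrlIntegrand [Fintype m] (S : LTISystem s m p) (t : ℝ) : Matrix s s ℝ :=
  NormedSpace.exp (t • S.A) * S.B * S.Bᵀ * NormedSpace.exp (t • S.Aᵀ)

/-- The integrand `e^{tAᵀ} Cᵀ C e^{tA}` of the observability Gramian. -/
noncomputable def obsIntegrand [Fintype p] (S : LTISystem s m p) (t : ℝ) : Matrix s s ℝ :=
  NormedSpace.exp (t • S.Aᵀ) * S.Cᵀ * S.C * NormedSpace.exp (t • S.A)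

/-- The (infinite-horizon) controllability Gramian `∫₀^∞ e^{tA} B Bᵀ e^{tAᵀ} dt`. -/
noncomputable def controllabilityGramian [Fintype m] (S : LTISystem s m p) : Matrix s s ℝ :=
  Matrix.of fun i j => ∫ t in Set.Ioi (0 : ℝ), S.ctrlIntegrand t i j

/-- Convergence of the integral that defines the controllability Gramian. -/
def HasControllabilityGramian [Fintype m] (S : LTISystem s m p) : Prop :=
  ∀ i j, MeasureTheory.IntegrableOn (fun t => S.ctrlIntegrand t i j) (Set.Ioi (0 : ℝ))

/-- The (infinite-horizon) observability Gramian `∫₀^∞ e^{tAᵀ} Cᵀ C e^{tA} dt`. -/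
noncomputable def observabilityGramian [Fintype p] (S : LTISystem s m p) : Matrix s s ℝ :=
  Matrix.of fun i j => ∫ t in Set.Ioi (0 : ℝ), S.obsIntegrand t i j

/-- Convergence of the integral that defines the observability Gramian. -/
def HasObservabilityGramian [Fintype p] (S : LTISystem s m p) : Prop :=
  ∀ i j, MeasureTheory.IntegrableOn (fun t => S.obsIntegrand t i j) (Set.Ioi (0 : ℝ))

end LTISystem

/-! ### Passive subsystems in port-Hamiltonian form -/

/-- A minimal port-Hamiltonian system `ẋ = (J - R) Q x + B v`, `z = Bᵀ Q x`. -/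
structure PortHamiltonian (n m : Type*) [Fintype n] [DecidableEq n] where
  J : Matrix n n ℝ
  R : Matrix n n ℝ
  Q : Matrix n n ℝ
  B : Matrix n m ℝ
  J_skew : Jᵀ = -J
  R_psd : R.PosSemidef
  Q_pd : Q.PosDef
  minimal : (LTISystem.mk ((J - R) * Q) B (Bᵀ * Q)).IsMinimal

namespace PortHamiltonian

variable {n m : Type*} [Fintype n] [DecidableEq n]

def A (S : PortHamiltonian n m) : Matrix n n ℝ := (S.J - S.R) * S.Q

def C (S : PortHamiltonian n m) : Matrix m n ℝ := S.Bᵀ * S.Q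

end PortHamiltonian

/-! ### Networks of identical subsystems -/

/-- Identical subsystems at the vertices `V`, coupled by
`v_i = ∑_{j ≠ i} w_ij (z_j - z_i) + ∑_j G_ij u_j`, with outputs `y_i = ∑_j H_ij z_j`. -/
structure Network (V n m U Y : Type*) [Fintype n] [DecidableEq n] where
  sub : PortHamiltonian n m
  w : V → V → ℝ
  w_nonneg : ∀ i j, 0 ≤ w i j
  G : Matrix V U ℝ
  H : Matrix Y V ℝ

/-- A directed rooted spanning tree on `V`: a directed tree connecting all vertices, in which every
vertex has exactly one incoming arc, except for a single root, which has none. -/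
def Digraph.IsDirectedRootedSpanningTree {V : Type*} (T : Digraph V) : Prop :=
  T.toSimpleGraphInclusive.IsTree ∧
    ∃ r : V, (∀ u, ¬ T.Adj u r) ∧ ∀ v, v ≠ r → ∃! u, T.Adj u v

/-- A numbering of the edges of `𝒢` by `ι`, together with an orientation: the edge numbered `l`
joins `fst l` and `snd l`. -/
structure EdgeOrientation {V : Type*} (𝒢 : SimpleGraph V) (ι : Type*) where
  edge : ι ≃ 𝒢.edgeSet
  fst : ι → V
  snd : ι → V
  edge_eq : ∀ l, (edge l : Sym2 V) = s(fst l, snd l)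

namespace Network

variable {V n m U Y ι : Type*} [Fintype V] [DecidableEq V] [Fintype n] [DecidableEq n]
  [Fintype m] [Fintype U] [Fintype Y] [Fintype ι] [DecidableEq ι]

/-- The Laplacian: `-w_ij` off the diagonal, `∑_{j ≠ i} w_ij` on the diagonal. -/
def laplacian (N : Network V n m U Y) : Matrix V V ℝ :=
  Matrix.of fun i j => if i = j then ∑ k ∈ Finset.univ.erase i, N.w i k else -N.w i j

/-- The networked system `ẋ = (I ⊗ A - L ⊗ BC) x + (G ⊗ B) u`, `y = (H ⊗ C) x`. -/
def toLTISystem (N : Network V n m U Y) : LTISystem (V × n) (U × m) (Y × m) where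
  A := (1 : Matrix V V ℝ) ⊗ₖ N.sub.A - N.laplacian ⊗ₖ (N.sub.B * N.sub.C)
  B := N.G ⊗ₖ N.sub.B
  C := N.H ⊗ₖ N.sub.C

/-- The directed graph of the network: `(i, j)` is an arc iff `w_ji > 0` (the weights `w_ii` do not
enter the coupling and give no loops). -/
def digraph (N : Network V n m U Y) : Digraph V where
  Adj i j := i ≠ j ∧ 0 < N.w j i

/-- The underlying undirected graph: `i` and `j` are adjacent iff `w_ij + w_ji > 0`. -/
def underlyingGraph (N : Network V n m U Y) : SimpleGraph V where
  Adj i j := i ≠ j ∧ 0 < N.w i j + N.w j i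
  symm := ⟨fun _ _ h => ⟨h.1.symm, by rw [add_comm]; exact h.2⟩⟩
  loopless := ⟨fun _ h => h.1 rfl⟩

/-- The underlying undirected graph is a tree, and the directed graph contains a directed rooted
spanning tree as a subgraph. -/
structure TreeAssumption (N : Network V n m U Y) : Prop where
  isTree : N.underlyingGraph.IsTree
  hasSpanningTree : ∃ T : Digraph V, T ≤ N.digraph ∧ T.IsDirectedRootedSpanningTree

/-- The oriented incidence matrix `E`: the column of the edge `l = (i, j)` is `e_i - e_j`. -/
def incE (N : Network V n m U Y) (o : EdgeOrientation N.underlyingGraph ι) : Matrix V ι ℝ :=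
  Matrix.of fun v l =>
    (Pi.single (o.fst l) (1 : ℝ) - Pi.single (o.snd l) (1 : ℝ) : V → ℝ) v

/-- The weighted matrix `F`: the column of the edge `l = (i, j)` is `w_ij e_i - w_ji e_j`. -/
def incF (N : Network V n m U Y) (o : EdgeOrientation N.underlyingGraph ι) : Matrix V ι ℝ :=
  Matrix.of fun v l =>
    (Pi.single (o.fst l) (N.w (o.fst l) (o.snd l))
      - Pi.single (o.snd l) (N.w (o.snd l) (o.fst l)) : V → ℝ) v

/-- The edge Laplacian `L_e = Eᵀ F`. -/
def edgeLaplacian (N : Network V n m U Y) (o : EdgeOrientation N.underlyingGraph ι) :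
    Matrix ι ι ℝ :=
  (N.incE o)ᵀ * N.incF o

/-- The edge system, with `G_e = Eᵀ G` and `H_e = H F (Eᵀ F)⁻¹`. -/
noncomputable def edgeSystem (N : Network V n m U Y) (o : EdgeOrientation N.underlyingGraph ι) :
    LTISystem (ι × n) (U × m) (Y × m) where
  A := (1 : Matrix ι ι ℝ) ⊗ₖ N.sub.A - N.edgeLaplacian o ⊗ₖ (N.sub.B * N.sub.C)
  B := ((N.incE o)ᵀ * N.G) ⊗ₖ N.sub.B
  C := (N.H * N.incF o * (N.edgeLaplacian o)⁻¹) ⊗ₖ N.sub.C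

/-- The dual edge system, with `G_f = (Eᵀ F)⁻¹ Eᵀ G` and `H_f = H F`. -/
noncomputable def dualEdgeSystem (N : Network V n m U Y)
    (o : EdgeOrientation N.underlyingGraph ι) :
    LTISystem (ι × n) (U × m) (Y × m) where
  A := (1 : Matrix ι ι ℝ) ⊗ₖ N.sub.A - N.edgeLaplacian o ⊗ₖ (N.sub.B * N.sub.C)
  B := ((N.edgeLaplacian o)⁻¹ * ((N.incE o)ᵀ * N.G)) ⊗ₖ N.sub.B
  C := (N.H * N.incF o) ⊗ₖ N.sub.C

/-- `piC ⊗ Q⁻¹` is a generalized edge controllability Gramian: `piC` is diagonal, `piC ≽ 0` and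
`L_e piC + piC L_eᵀ - Eᵀ G Gᵀ E ≽ 0`. -/
structure IsGenEdgeControllability (N : Network V n m U Y)
    (o : EdgeOrientation N.underlyingGraph ι) (piC : Matrix ι ι ℝ) : Prop where
  isDiag : piC.IsDiag
  psd : piC.PosSemidef
  lmi : (N.edgeLaplacian o * piC + piC * (N.edgeLaplacian o)ᵀ
    - (N.incE o)ᵀ * N.G * N.Gᵀ * N.incE o).PosSemidef

/-- `piO ⊗ Q` is a generalized edge observability Gramian: `piO` is diagonal, `piO ≽ 0` and
`L_eᵀ piO + piO L_e - Fᵀ Hᵀ H F ≽ 0`. -/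
structure IsGenEdgeObservability (N : Network V n m U Y)
    (o : EdgeOrientation N.underlyingGraph ι) (piO : Matrix ι ι ℝ) : Prop where
  isDiag : piO.IsDiag
  psd : piO.PosSemidef
  lmi : ((N.edgeLaplacian o)ᵀ * piO + piO * N.edgeLaplacian o
    - (N.incF o)ᵀ * N.Hᵀ * N.H * N.incF o).PosSemidef

/-- The edge controllability Gramian: the controllability Gramian of the edge system. -/
noncomputable def edgeControllabilityGramian (N : Network V n m U Y)
    (o : EdgeOrientation N.underlyingGraph ι) : Matrix (ι × n) (ι × n) ℝ :=
  (N.edgeSystem o).controllabilityGramian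

/-- The edge observability Gramian: the observability Gramian of the dual edge system. -/
noncomputable def edgeObservabilityGramian (N : Network V n m U Y)
    (o : EdgeOrientation N.underlyingGraph ι) : Matrix (ι × n) (ι × n) ℝ :=
  (N.dualEdgeSystem o).observabilityGramian

end Network

/-!
A matrix `X ≽ 0` with `Aᵀ X + X A + Cᵀ C ≼ 0` makes `V(x) = xᵀ X x` decrease along `ẋ = A x` at rate
at least `‖C x‖²`. So the output energy `∫₀^∞ ‖C e^{tA} v‖² dt`, which is the quadratic form of the
observability Gramian at `v`, is at most `vᵀ X v`. Polarization turns convergence of the quadratic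
form into entrywise convergence of the Gramian.

If `Q` is a storage matrix of a passive system, `Aᵀ Q + Q A ≼ 0` and `Q B = Cᵀ`, then for
`𝒜 = I ⊗ A - L ⊗ BC` the feedback terms collapse to multiples of `Cᵀ C`:
`-(𝒜ᵀ (P ⊗ Q) + (P ⊗ Q) 𝒜) = P ⊗ (-(Aᵀ Q + Q A)) + (Lᵀ P + P L) ⊗ Cᵀ C`.
Hence `Lᵀ P + P L ≽ Hᵀ H` makes `X = P ⊗ Q` such a matrix for the output matrix `H ⊗ C`.

The controllability statement is the observability statement for the dual system `(Aᵀ, Cᵀ, Bᵀ)`: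
the dual of an interconnection interconnects the dual subsystems through `Lᵀ`, and `Q⁻¹` is a
storage matrix of the dual subsystem.
-/

section DissipationInequality

open MeasureTheory Filter Set

variable {a : ℝ} {V V' φ : ℝ → ℝ}

theorem intervalIntegral_le_of_hasDerivAt_le_neg (hV : ∀ t ∈ Ici a, 0 ≤ V t)
    (hderiv : ∀ t ∈ Ici a, HasDerivAt V (V' t) t) (hφ : LocallyIntegrableOn φ (Ici a))
    (hle : ∀ t ∈ Ici a, V' t ≤ -φ t) {T : ℝ} (hT : a ≤ T) : ∫ t in a..T, φ t ≤ V a := by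
  have hloss : ∫ t in a..T, φ t ≤ -V T - -V a :=
    intervalIntegral.integral_le_sub_of_hasDeriv_right_of_le hT
      (fun t ht => (hderiv t ht.1).neg.continuousAt.continuousWithinAt)
      (fun t ht => (hderiv t ht.1.le).neg.hasDerivWithinAt)
      (hφ.integrableOn_compact_subset Icc_subset_Ici_self isCompact_Icc)
      (fun t ht => le_neg_of_le_neg (hle t ht.1.le))
  linarith [hV T hT]

theorem integrableOn_Ioi_and_integral_le_of_hasDerivAt_le_neg (hV : ∀ t ∈ Ici a, 0 ≤ V t)
    (hderiv : ∀ t ∈ Ici a, HasDerivAt V (V' t) t) (hφ : LocallyIntegrableOn φ (Ici a))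
    (hφ_nonneg : ∀ t ∈ Ici a, 0 ≤ φ t) (hle : ∀ t ∈ Ici a, V' t ≤ -φ t) :
    IntegrableOn φ (Ioi a) ∧ ∫ t in Ioi a, φ t ≤ V a := by
  have hbound : ∀ᶠ T in atTop, ∫ t in a..T, φ t ≤ V a := by
    filter_upwards [eventually_ge_atTop a] with T hT
    exact intervalIntegral_le_of_hasDerivAt_le_neg hV hderiv hφ hle hT
  have hint : IntegrableOn φ (Ioi a) := by
    refine integrableOn_Ioi_of_intervalIntegral_norm_bounded (V a) a (fun T : ℝ =>
      (hφ.integrableOn_compact_subset Icc_subset_Ici_self isCompact_Icc).mono_set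
        Ioc_subset_Icc_self) tendsto_id ?_
    filter_upwards [eventually_ge_atTop a, hbound] with T hT hle_T
    have hnorm : ∫ t in a..T, ‖φ t‖ = ∫ t in a..T, φ t :=
      intervalIntegral.integral_congr fun t ht =>
        Real.norm_of_nonneg (hφ_nonneg t (uIcc_of_le hT ▸ ht).1)
    exact hnorm.trans_le hle_T
  exact ⟨hint, le_of_tendsto (intervalIntegral_tendsto_integral_Ioi a hint tendsto_id) hbound⟩

end DissipationInequality

theorem dotProduct_eq_polarization {p : Type*} [Fintype p] (x y : p → ℝ) :
    x ⬝ᵥ y = 4⁻¹ * ((x + y) ⬝ᵥ (x + y) - (x - y) ⬝ᵥ (x - y)) := by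
  simp only [add_dotProduct, dotProduct_add, sub_dotProduct, dotProduct_sub, dotProduct_comm y x]
  ring

theorem hasDerivAt_dotProduct_mulVec_self {s : Type*} [Fintype s] {x : ℝ → s → ℝ} {x' : s → ℝ}
    {t : ℝ} (X : Matrix s s ℝ) (hx : HasDerivAt x x' t) :
    HasDerivAt (fun t => x t ⬝ᵥ X *ᵥ x t) (x' ⬝ᵥ X *ᵥ x t + x t ⬝ᵥ X *ᵥ x') t := by
  have hXx : HasDerivAt (fun t => X *ᵥ x t) (X *ᵥ x') t :=
    X.mulVecLin.toContinuousLinearMap.hasFDerivAt.comp_hasDerivAt t hx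
  refine (HasDerivAt.fun_sum fun i _ =>
    (hasDerivAt_pi.1 hx i).fun_mul (hasDerivAt_pi.1 hXx i)).congr_deriv ?_
  rw [Finset.sum_add_distrib, dotProduct, dotProduct]

namespace LTISystem

open MeasureTheory

section Observability

variable {s m p : Type*} [Fintype s] [DecidableEq s] (S : LTISystem s m p)

/-- The solution `t ↦ e^{tA} v` of the unforced equation `ẋ = A x` with `x(0) = v`. -/
noncomputable def freeState (v : s → ℝ) (t : ℝ) : s → ℝ :=
  NormedSpace.exp (t • S.A) *ᵥ v

/-- The output `t ↦ C e^{tA} v` of the unforced system started at `v`; its energy is the quadratic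
form of the observability Gramian. -/
noncomputable def freeOutput (v : s → ℝ) (t : ℝ) : p → ℝ :=
  S.C *ᵥ S.freeState v t

@[simp]
theorem freeState_zero (v : s → ℝ) : S.freeState v 0 = v := by
  simp [freeState]

attribute [local instance] Matrix.linftyOpNormedRing Matrix.linftyOpNormedAlgebra in
theorem hasDerivAt_freeState (v : s → ℝ) (t : ℝ) :
    HasDerivAt (S.freeState v) (S.A *ᵥ S.freeState v t) t := by
  rw [freeState, Matrix.mulVec_mulVec]
  exact ((Matrix.mulVecBilin ℝ ℝ).flip v).toContinuousLinearMap.hasFDerivAt.comp_hasDerivAt t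
    (hasDerivAt_exp_smul_const' (𝕂 := ℝ) S.A t)

theorem continuous_freeOutput (v : s → ℝ) : Continuous (S.freeOutput v) :=
  continuous_const.matrix_mulVec <|
    continuous_iff_continuousAt.2 fun t => (S.hasDerivAt_freeState v t).continuousAt

theorem freeOutput_add (v w : s → ℝ) (t : ℝ) :
    S.freeOutput (v + w) t = S.freeOutput v t + S.freeOutput w t := by
  simp only [freeOutput, freeState, Matrix.mulVec_add]

theorem freeOutput_sub (v w : s → ℝ) (t : ℝ) :
    S.freeOutput (v - w) t = S.freeOutput v t - S.freeOutput w t := by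
  simp only [freeOutput, freeState, Matrix.mulVec_sub]

variable [Fintype p]

theorem dotProduct_obsIntegrand_mulVec (v w : s → ℝ) (t : ℝ) :
    v ⬝ᵥ S.obsIntegrand t *ᵥ w = S.freeOutput v t ⬝ᵥ S.freeOutput w t := by
  have hexp : NormedSpace.exp (t • S.Aᵀ) = (NormedSpace.exp (t • S.A))ᵀ := by
    rw [← Matrix.transpose_smul, Matrix.exp_transpose]
  simp only [obsIntegrand, freeOutput, freeState, hexp, ← Matrix.mulVec_mulVec]
  rw [Matrix.dotProduct_transpose_mulVec, dotProduct_comm, Matrix.dotProduct_transpose_mulVec,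
    dotProduct_comm]

theorem obsIntegrand_apply (t : ℝ) (i j : s) :
    S.obsIntegrand t i j
      = S.freeOutput (Pi.single i 1) t ⬝ᵥ S.freeOutput (Pi.single j 1) t := by
  rw [← dotProduct_obsIntegrand_mulVec, single_one_dotProduct, Matrix.mulVec_single_one,
    Matrix.col_apply]

theorem observabilityGramian_isHermitian : S.observabilityGramian.IsHermitian := by
  ext i j
  simp only [Matrix.conjTranspose_apply, star_trivial, observabilityGramian, Matrix.of_apply,
    obsIntegrand_apply]
  exact integral_congr_ae (.of_forall fun t => dotProduct_comm _ _)

variable {S} in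
theorem hasObservabilityGramian_of_integrableOn_energy
    (h : ∀ v, IntegrableOn (fun t => S.freeOutput v t ⬝ᵥ S.freeOutput v t) (Set.Ioi 0)) :
    S.HasObservabilityGramian := by
  intro i j
  simp only [obsIntegrand_apply, dotProduct_eq_polarization (S.freeOutput _ _)]
  simp only [← freeOutput_add, ← freeOutput_sub]
  exact ((h _).sub (h _)).const_mul _

variable {S} in
theorem HasObservabilityGramian.dotProduct_observabilityGramian_mulVec
    (hS : S.HasObservabilityGramian) (v w : s → ℝ) :
    v ⬝ᵥ S.observabilityGramian *ᵥ w
      = ∫ t in Set.Ioi (0 : ℝ), S.freeOutput v t ⬝ᵥ S.freeOutput w t := by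
  have hrow (i : s) : Integrable (fun t => (S.obsIntegrand t *ᵥ w) i)
      (volume.restrict (Set.Ioi (0 : ℝ))) :=
    integrable_finsetSum _ fun j _ => (hS i j).mul_const _
  simp only [← dotProduct_obsIntegrand_mulVec]
  simp only [dotProduct]
  rw [integral_finsetSum _ fun i _ => (hrow i).const_mul _]
  simp only [Matrix.mulVec, dotProduct, observabilityGramian, Matrix.of_apply, integral_const_mul]
  refine Finset.sum_congr rfl fun i _ => ?_
  rw [integral_finsetSum _ fun j _ => (hS i j).mul_const _]
  simp only [integral_mul_const]

end Observability

section GeneralizedGramian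

variable {s m p : Type*} [Fintype s] [Fintype p]

/-- A generalized observability Gramian: a solution `X ≽ 0` of the Lyapunov inequality
`Aᵀ X + X A + Cᵀ C ≼ 0`. -/
structure IsGenObservabilityGramian (S : LTISystem s m p) (X : Matrix s s ℝ) : Prop where
  posSemidef : X.PosSemidef
  lyapunov : (-(S.Aᵀ * X + X * S.A) - S.Cᵀ * S.C).PosSemidef

namespace IsGenObservabilityGramian

variable {S : LTISystem s m p} {X : Matrix s s ℝ}

theorem dotProduct_mulVec_add_le (h : S.IsGenObservabilityGramian X) (x : s → ℝ) :
    (S.A *ᵥ x) ⬝ᵥ X *ᵥ x + x ⬝ᵥ X *ᵥ (S.A *ᵥ x) ≤ -((S.C *ᵥ x) ⬝ᵥ (S.C *ᵥ x)) := by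
  have hx := h.lyapunov.dotProduct_mulVec_nonneg x
  simp only [star_trivial, Matrix.sub_mulVec, Matrix.neg_mulVec, Matrix.add_mulVec,
    ← Matrix.mulVec_mulVec, dotProduct_sub, dotProduct_neg, dotProduct_add,
    Matrix.dotProduct_transpose_mulVec] at hx
  rw [dotProduct_comm (X *ᵥ x)] at hx
  linarith

variable [DecidableEq s]

theorem integrableOn_energy_and_integral_le (h : S.IsGenObservabilityGramian X) (v : s → ℝ) :
    IntegrableOn (fun t => S.freeOutput v t ⬝ᵥ S.freeOutput v t) (Set.Ioi 0) ∧
      ∫ t in Set.Ioi (0 : ℝ), S.freeOutput v t ⬝ᵥ S.freeOutput v t ≤ v ⬝ᵥ X *ᵥ v := by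
  have henergy : Continuous fun t => S.freeOutput v t ⬝ᵥ S.freeOutput v t :=
    (S.continuous_freeOutput v).dotProduct (S.continuous_freeOutput v)
  simpa only [freeState_zero, star_trivial] using
    integrableOn_Ioi_and_integral_le_of_hasDerivAt_le_neg (a := 0)
      (fun t _ => h.posSemidef.dotProduct_mulVec_nonneg (S.freeState v t))
      (fun t _ => hasDerivAt_dotProduct_mulVec_self X (S.hasDerivAt_freeState v t))
      (henergy.locallyIntegrable.locallyIntegrableOn _)
      (fun t _ => dotProduct_self_star_nonneg (S.freeOutput v t))
      (fun t _ => h.dotProduct_mulVec_add_le (S.freeState v t))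

theorem hasObservabilityGramian (h : S.IsGenObservabilityGramian X) :
    S.HasObservabilityGramian :=
  hasObservabilityGramian_of_integrableOn_energy fun v =>
    (h.integrableOn_energy_and_integral_le v).1

theorem posSemidef_sub_observabilityGramian (h : S.IsGenObservabilityGramian X) :
    (X - S.observabilityGramian).PosSemidef := by
  refine .of_dotProduct_mulVec_nonneg
    (h.posSemidef.isHermitian.sub S.observabilityGramian_isHermitian) fun v => ?_
  rw [star_trivial, Matrix.sub_mulVec, dotProduct_sub,
    h.hasObservabilityGramian.dotProduct_observabilityGramian_mulVec, sub_nonneg]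
  exact (h.integrableOn_energy_and_integral_le v).2

end IsGenObservabilityGramian

end GeneralizedGramian

/-- The dual system `ẋ = Aᵀ x + Cᵀ u`, `y = Bᵀ x`, which exchanges controllability and
observability. -/
def dual {s m p : Type*} (S : LTISystem s m p) : LTISystem s p m := ⟨S.Aᵀ, S.Cᵀ, S.Bᵀ⟩

section Duality

variable {s m p : Type*} [Fintype s] [DecidableEq s] [Fintype m] (S : LTISystem s m p)

theorem hasObservabilityGramian_dual :
    S.dual.HasObservabilityGramian ↔ S.HasControllabilityGramian :=
  Iff.rfl

theorem observabilityGramian_dual : S.dual.observabilityGramian = S.controllabilityGramian :=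
  rfl

end Duality

section Passivity

variable {n m : Type*} [Fintype n]

/-- `Q` is a storage matrix of a system with as many inputs as outputs: `x ↦ xᵀ Q x / 2` is a
storage function certifying passivity, expressed by the Kalman–Yakubovich–Popov conditions. -/
structure IsStorageMatrix (S : LTISystem n m m) (Q : Matrix n n ℝ) : Prop where
  posSemidef : Q.PosSemidef
  dissipative : (-(S.Aᵀ * Q + Q * S.A)).PosSemidef
  transpose_B_mul : S.Bᵀ * Q = S.C

namespace IsStorageMatrix

variable {S : LTISystem n m m} {Q : Matrix n n ℝ}

theorem transpose_eq (h : S.IsStorageMatrix Q) : Qᵀ = Q :=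
  h.posSemidef.isHermitian.eq

theorem mul_B (h : S.IsStorageMatrix Q) : Q * S.B = S.Cᵀ := by
  rw [← h.transpose_B_mul, Matrix.transpose_mul, h.transpose_eq, Matrix.transpose_transpose]

theorem dual [DecidableEq n] (h : S.IsStorageMatrix Q) (hQ : IsUnit Q) :
    S.dual.IsStorageMatrix Q⁻¹ where
  posSemidef := h.posSemidef.inv
  dissipative := by
    have hdet := Q.isUnit_iff_isUnit_det.1 hQ
    have hcongr := h.dissipative.mul_mul_conjTranspose_same Q⁻¹
    rw [h.posSemidef.isHermitian.inv.eq] at hcongr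
    convert hcongr using 1
    simp only [LTISystem.dual, Matrix.transpose_transpose, Matrix.mul_neg, Matrix.neg_mul,
      Matrix.mul_add, Matrix.add_mul, Matrix.mul_assoc, Matrix.mul_nonsing_inv Q hdet,
      Matrix.nonsing_inv_mul_cancel_left _ _ hdet, Matrix.mul_one, add_comm]
  transpose_B_mul := by
    change S.C * Q⁻¹ = S.Bᵀ
    rw [← h.transpose_B_mul,
      Matrix.mul_nonsing_inv_cancel_right _ _ (Q.isUnit_iff_isUnit_det.1 hQ)]

end IsStorageMatrix

end Passivity

section Interconnection

variable {n m U Y ι : Type*} [Fintype m] [DecidableEq ι]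

/-- Copies `ẋ_i = A x_i + B v_i`, `z_i = C x_i` of the system `S`, interconnected through
`v = -(L ⊗ I) z + (G ⊗ I) u` and observed through `y = (H ⊗ I) z`. -/
def interconnection (S : LTISystem n m m) (L : Matrix ι ι ℝ) (G : Matrix ι U ℝ)
    (H : Matrix Y ι ℝ) : LTISystem (ι × n) (U × m) (Y × m) where
  A := (1 : Matrix ι ι ℝ) ⊗ₖ S.A - L ⊗ₖ (S.B * S.C)
  B := G ⊗ₖ S.B
  C := H ⊗ₖ S.C

theorem dual_interconnection (S : LTISystem n m m) (L : Matrix ι ι ℝ) (G : Matrix ι U ℝ)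
    (H : Matrix Y ι ℝ) :
    (S.interconnection L G H).dual = S.dual.interconnection Lᵀ Hᵀ Gᵀ := by
  simp only [interconnection, dual, Matrix.transpose_sub, ← Matrix.kroneckerMap_transpose,
    Matrix.transpose_one, Matrix.transpose_mul]

variable [Fintype n] [Fintype ι] [Fintype Y] {S : LTISystem n m m} {Q : Matrix n n ℝ}

theorem IsStorageMatrix.lyapunov_interconnection_eq (h : S.IsStorageMatrix Q)
    (L P : Matrix ι ι ℝ) (G : Matrix ι U ℝ) (H : Matrix Y ι ℝ) :
    -((S.interconnection L G H).Aᵀ * (P ⊗ₖ Q) + (P ⊗ₖ Q) * (S.interconnection L G H).A)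
        - (S.interconnection L G H).Cᵀ * (S.interconnection L G H).C
      = P ⊗ₖ (-(S.Aᵀ * Q + Q * S.A)) + (Lᵀ * P + P * L - Hᵀ * H) ⊗ₖ (S.Cᵀ * S.C) := by
  have hleft : (S.interconnection L G H).Aᵀ * (P ⊗ₖ Q)
      = P ⊗ₖ (S.Aᵀ * Q) - (Lᵀ * P) ⊗ₖ (S.Cᵀ * S.C) := by
    simp only [interconnection, Matrix.transpose_sub, ← Matrix.kroneckerMap_transpose,
      Matrix.transpose_one, Matrix.transpose_mul, Matrix.sub_mul, ← Matrix.mul_kronecker_mul,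
      Matrix.one_mul, Matrix.mul_assoc, h.transpose_B_mul]
  have hright : (P ⊗ₖ Q) * (S.interconnection L G H).A
      = P ⊗ₖ (Q * S.A) - (P * L) ⊗ₖ (S.Cᵀ * S.C) := by
    simp only [interconnection, Matrix.mul_sub, ← Matrix.mul_kronecker_mul, Matrix.mul_one,
      ← Matrix.mul_assoc, h.mul_B]
  have houtput : (S.interconnection L G H).Cᵀ * (S.interconnection L G H).C
      = (Hᵀ * H) ⊗ₖ (S.Cᵀ * S.C) := by
    simp only [interconnection, ← Matrix.kroneckerMap_transpose, ← Matrix.mul_kronecker_mul]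
  rw [hleft, hright, houtput]
  ext ⟨i, a⟩ ⟨j, b⟩
  simp only [Matrix.kronecker_apply, Matrix.add_apply, Matrix.sub_apply, Matrix.neg_apply]
  ring

theorem IsStorageMatrix.isGenObservabilityGramian_kronecker (h : S.IsStorageMatrix Q)
    {L P : Matrix ι ι ℝ} (G : Matrix ι U ℝ) {H : Matrix Y ι ℝ} (hP : P.PosSemidef)
    (hL : (Lᵀ * P + P * L - Hᵀ * H).PosSemidef) :
    (S.interconnection L G H).IsGenObservabilityGramian (P ⊗ₖ Q) where
  posSemidef := hP.kronecker h.posSemidef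
  lyapunov := by
    rw [h.lyapunov_interconnection_eq]
    exact (hP.kronecker h.dissipative).add
      (hL.kronecker (Matrix.posSemidef_conjTranspose_mul_self S.C))

end Interconnection

end LTISystem

namespace PortHamiltonian

variable {n m : Type*} [Fintype n] [DecidableEq n]

/-- The input-output system `ẋ = (J - R) Q x + B v`, `z = Bᵀ Q x` of a port-Hamiltonian system. -/
def toLTISystem (S : PortHamiltonian n m) : LTISystem n m m := ⟨S.A, S.B, S.C⟩

theorem isStorageMatrix (S : PortHamiltonian n m) : S.toLTISystem.IsStorageMatrix S.Q where
  posSemidef := S.Q_pd.posSemidef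
  dissipative := by
    have hQ : S.Qᵀ = S.Q := S.Q_pd.isHermitian.eq
    have hR : S.Rᵀ = S.R := S.R_psd.isHermitian.eq
    convert (S.R_psd.add S.R_psd).mul_mul_conjTranspose_same S.Q using 1
    simp only [toLTISystem, A, Matrix.conjTranspose_eq_transpose_of_trivial, hQ,
      Matrix.transpose_mul, Matrix.transpose_sub, S.J_skew, hR]
    noncomm_ring
  transpose_B_mul := rfl

end PortHamiltonian

theorem mainTheorem3_general {n m U Y ι : Type*} [Fintype n] [DecidableEq n] [Fintype m]
    [Fintype U] [Fintype Y] [Fintype ι] [DecidableEq ι] {S : LTISystem n m m} {Q : Matrix n n ℝ}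
    (hS : S.IsStorageMatrix Q) (hQ : IsUnit Q) (L : Matrix ι ι ℝ) (G : Matrix ι U ℝ)
    (H : Matrix Y ι ℝ) :
    (∀ P : Matrix ι ι ℝ, P.PosSemidef → (L * P + P * Lᵀ - G * Gᵀ).PosSemidef →
      (S.interconnection L G H).HasControllabilityGramian ∧
      (P ⊗ₖ Q⁻¹ - (S.interconnection L G H).controllabilityGramian).PosSemidef) ∧
    (∀ P : Matrix ι ι ℝ, P.PosSemidef → (Lᵀ * P + P * L - Hᵀ * H).PosSemidef →
      (S.interconnection L G H).HasObservabilityGramian ∧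
      (P ⊗ₖ Q - (S.interconnection L G H).observabilityGramian).PosSemidef) := by
  refine ⟨fun P hP hL => ?_, fun P hP hL => ?_⟩
  · have hX : (S.interconnection L G H).dual.IsGenObservabilityGramian (P ⊗ₖ Q⁻¹) := by
      rw [LTISystem.dual_interconnection]
      exact (hS.dual hQ).isGenObservabilityGramian_kronecker Hᵀ hP hL
    rw [← LTISystem.hasObservabilityGramian_dual, ← LTISystem.observabilityGramian_dual]
    exact ⟨hX.hasObservabilityGramian, hX.posSemidef_sub_observabilityGramian⟩
  · have hX := hS.isGenObservabilityGramian_kronecker G hP hL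
    exact ⟨hX.hasObservabilityGramian, hX.posSemidef_sub_observabilityGramian⟩

theorem mainTheorem3
    {V n m U Y ι : Type*} [Fintype V] [DecidableEq V] [Fintype n] [DecidableEq n]
    [Fintype m] [Fintype U] [Fintype Y] [Fintype ι] [DecidableEq ι]
    (N : Network V n m U Y) (hN : N.TreeAssumption)
    (o : EdgeOrientation N.underlyingGraph ι) :
    (∀ piC : Matrix ι ι ℝ, N.IsGenEdgeControllability o piC →
      (N.edgeSystem o).HasControllabilityGramian ∧
      (piC ⊗ₖ N.sub.Q⁻¹ - N.edgeControllabilityGramian o).PosSemidef) ∧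
    (∀ piO : Matrix ι ι ℝ, N.IsGenEdgeObservability o piO →
      (N.dualEdgeSystem o).HasObservabilityGramian ∧
      (piO ⊗ₖ N.sub.Q - N.edgeObservabilityGramian o).PosSemidef) := by
  have hS := N.sub.isStorageMatrix
  have hQ := N.sub.Q_pd.isUnit
  refine ⟨fun piC h => (mainTheorem3_general hS hQ _ _ _).1 piC h.psd ?_,
    fun piO h => (mainTheorem3_general hS hQ _ _ _).2 piO h.psd ?_⟩
  · simpa only [Matrix.transpose_mul, Matrix.transpose_transpose, Matrix.mul_assoc] using h.lmi
  · simpa only [Matrix.transpose_mul, Matrix.mul_assoc] using h.lmi
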